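/- Call a finite group $G$ an $\mathcal{NC}$-group if every normal subgroup $N$ of $G$ is complemented in $G$, i.e. there is a subgroup $C \le G$ with $NC = G$ and $N \cap C = 1$. The class of $\mathcal{NC}$-groups is subnormally closed: if $G$ is a finite $\mathcal{NC}$-group and $H$ is a subnormal subgroup of $G$ (i.e. there is a finite chain $H = H_0 \trianglelefteq H_1 \trianglelefteq \dots \trianglelefteq H_n = G$), then $H$ is an $\mathcal{NC}$-group. -/

import Mathlib

/-- `G` is an `NC`-group: every normal subgroup `N` of `G` is complemented in `G`, i.e. there is
a subgroup `C` (not necessarily normal) with `N C = G` and `N ∩ C = 1`. -/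
def IsNCGroup (G : Type*) [Group G] : Prop :=
  ∀ N : Subgroup G, N.Normal → ∃ C : Subgroup G, Subgroup.IsComplement' N C

/-! Descending the subnormal chain reduces to `H` normal in `G`. There one proves a relative form,
by induction from `H` down to `⊥` along normal subgroups `N` of `G`: any `K ≥ N` normal in `H` has a
complement in `H` modulo `N`. Each step crosses a chief factor `N' / N`. It is semisimple under `H`
by Clifford, which splits off the part of `K` inside `N'`; a complement of `N'` in `G` handles the
rest. -/

open Subgroup

/-- If `E` normalizes `M`, then `M ⊔ E` is the set of products `m * e`. -/
theorem Subgroup.mem_sup_of_le_normalizer {G : Type*} [Group G] {M E : Subgroup G}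
    (h : E ≤ normalizer (M : Set G)) {x : G} :
    x ∈ M ⊔ E ↔ ∃ m ∈ M, ∃ e ∈ E, m * e = x := by
  rw [← SetLike.mem_coe, coe_mul_of_right_le_normalizer_left M E h, Set.mem_mul]
  rfl

/-- The join of two subgroups normalized by `H` is normalized by `H`. -/
theorem Subgroup.le_normalizer_sup {G : Type*} [Group G] {H A B : Subgroup G}
    (hA : H ≤ normalizer (A : Set G)) (hB : H ≤ normalizer (B : Set G)) :
    H ≤ normalizer ((A ⊔ B : Subgroup G) : Set G) :=
  (le_inf hA hB).trans (normalizer_inf_normalizer_le_normalizer_sup A B)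

/-- The meet of two subgroups normalized by `H` is normalized by `H`. -/
theorem Subgroup.le_normalizer_inf {G : Type*} [Group G] {H A B : Subgroup G}
    (hA : H ≤ normalizer (A : Set G)) (hB : H ≤ normalizer (B : Set G)) :
    H ≤ normalizer ((A ⊓ B : Subgroup G) : Set G) := by
  rw [le_normalizer_iff] at *
  exact fun h hh k hk => ⟨hA h hh k hk.1, hB h hh k hk.2⟩

/-- A conjugate of a subgroup normalized by a normal subgroup `H` is normalized by `H`. -/
theorem Subgroup.le_normalizer_map_conj {G : Type*} [Group G] {H A : Subgroup G} [hH : H.Normal]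
    (hA : H ≤ normalizer (A : Set G)) (g : G) :
    H ≤ normalizer ((A.map (MulAut.conj g).toMonoidHom : Subgroup G) : Set G) := by
  rw [le_normalizer_iff] at *
  rintro h hh _ ⟨a, ha, rfl⟩
  refine ⟨(g⁻¹ * h * g) * a * (g⁻¹ * h * g)⁻¹, hA _ ?_ a ha, ?_⟩
  · simpa using hH.conj_mem h hh g⁻¹
  · simp [mul_assoc]

/-- A form of Clifford's theorem for chief factors: if `N' / N` is a chief factor of `G` and `H` is
a normal subgroup of `G` containing `N'`, then every `H`-invariant subgroup between `N` and
`N'` has an `H`-invariant complement in the interval `[N, N']`. -/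
theorem Subgroup.exists_invariant_complement_of_chief_factor {G : Type*} [Group G] [Finite G]
    {H N N' B : Subgroup G} [H.Normal] [hN : N.Normal] (hN'H : N' ≤ H)
    (hmin : Minimal (fun X : Subgroup G => X.Normal ∧ N < X) N')
    (hNB : N ≤ B) (hBN' : B ≤ N') (hB : H ≤ normalizer (B : Set G)) :
    ∃ M : Subgroup G, H ≤ normalizer (M : Set G) ∧ N ≤ M ∧ M ≤ N' ∧ B ⊔ M = N' ∧ B ⊓ M = N := by
  have hnorm : N'.Normal := hmin.prop.1
  obtain ⟨M, hM⟩ := (Set.toFinite {M : Subgroup G | H ≤ normalizer (M : Set G) ∧ N ≤ M ∧ M ≤ N' ∧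
    B ⊓ M = N}).exists_maximal
      ⟨N, le_normalizer_of_normal, le_rfl, hNB.trans hBN', inf_eq_right.2 hNB⟩
  obtain ⟨hMH, hNM, hMN', hBM⟩ := hM.prop
  refine ⟨M, hMH, hNM, hMN', ?_, hBM⟩
  by_contra hne
  -- The conjugates of a minimal `A` generate `N'`, so one of them escapes `B ⊔ M` and can be
  -- adjoined to `M`, against maximality.
  obtain ⟨A, hA⟩ := (Set.toFinite {A : Subgroup G | H ≤ normalizer (A : Set G) ∧ N < A ∧
    A ≤ N'}).exists_minimal ⟨N', le_normalizer_of_normal, hmin.prop.2, le_rfl⟩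
  obtain ⟨hAH, hNA, hAN'⟩ := hA.prop
  have hle : N' ≤ normalClosure (A : Set G) :=
    hmin.le_of_le ⟨normalClosure_normal, hNA.trans_le subset_normalClosure⟩
      (normalClosure_le_normal hAN')
  have hex : ∃ g : G, ¬ A.map (MulAut.conj g).toMonoidHom ≤ B ⊔ M := by
    by_contra! hall
    refine hne (le_antisymm (sup_le hBN' hMN') (hle.trans ?_))
    refine (closure_le _).2 fun x hx => ?_
    obtain ⟨a, ha, hax⟩ := Group.mem_conjugatesOfSet_iff.1 hx
    obtain ⟨g, rfl⟩ := isConj_iff.1 hax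
    exact hall g ⟨a, ha, rfl⟩
  obtain ⟨g, hg⟩ := hex
  set A' := A.map (MulAut.conj g).toMonoidHom with hA'
  have hA'H : H ≤ normalizer (A' : Set G) := le_normalizer_map_conj hAH g
  have hA'N' : A' ≤ N' := by
    rintro _ ⟨a, ha, rfl⟩
    exact hnorm.conj_mem a (hAN' ha) g
  have hback : ∀ X : Subgroup G, X ≤ A' → X.map (MulAut.conj g⁻¹).toMonoidHom ≤ A := by
    rintro X hX _ ⟨x, hx, rfl⟩
    obtain ⟨a, ha, rfl⟩ := hX hx
    simpa [mul_assoc] using ha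
  -- The conjugate `A'` is again minimal, so it meets `B ⊔ M` in `N`.
  have hdisj : A' ⊓ (B ⊔ M) ≤ N := by
    intro x hx
    by_contra hxN
    set D := N ⊔ A' ⊓ (B ⊔ M)
    have hNA' : N ≤ A' := fun n hn =>
      ⟨g⁻¹ * n * g, hNA.le (by simpa using hN.conj_mem n hn g⁻¹), by simp [mul_assoc]⟩
    have hDA' : D ≤ A' := sup_le hNA' inf_le_left
    have hDH : H ≤ normalizer (D : Set G) :=
      le_normalizer_sup le_normalizer_of_normal (le_normalizer_inf hA'H (le_normalizer_sup hB hMH))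
    have hxD : x ∈ D := (le_sup_right : _ ≤ D) hx
    have hAD : A ≤ D.map (MulAut.conj g⁻¹).toMonoidHom := by
      refine hA.le_of_le ⟨le_normalizer_map_conj hDH g⁻¹, lt_of_le_not_ge ?_ ?_, ?_⟩ (hback D hDA')
      · exact fun n hn => ⟨g * n * g⁻¹, (le_sup_left : N ≤ D) (hN.conj_mem n hn g),
          by simp [mul_assoc]⟩
      · intro h
        have h1 := hN.conj_mem _ (h ⟨x, hxD, rfl⟩) g
        exact hxN (by simpa [mul_assoc] using h1)
      · exact (hback D hDA').trans hAN'
    refine hg ?_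
    rintro _ ⟨a, ha, rfl⟩
    obtain ⟨d, hd, rfl⟩ := hAD ha
    have : D ≤ B ⊔ M := sup_le (hNB.trans le_sup_left) inf_le_right
    simpa [mul_assoc] using this hd
  have hMA : M ⊔ A' ≤ M := by
    refine hM.le_of_ge ⟨le_normalizer_sup hMH hA'H, hNM.trans le_sup_left, sup_le hMN' hA'N',
      le_antisymm ?_ (le_inf hNB (hNM.trans le_sup_left))⟩ le_sup_left
    rintro x ⟨hxB, hxMA⟩
    obtain ⟨m, hm, a, ha, rfl⟩ :=
      (mem_sup_of_le_normalizer ((hA'N'.trans hN'H).trans hMH)).1 hxMA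
    have haBM : a ∈ B ⊔ M := by
      have := mul_mem (inv_mem ((le_sup_right : M ≤ B ⊔ M) hm)) ((le_sup_left : B ≤ B ⊔ M) hxB)
      simpa using this
    have haN : a ∈ N := hdisj ⟨ha, haBM⟩
    exact hBM.le ⟨hxB, mul_mem hm (hNM haN)⟩
  exact hg ((le_sup_right.trans hMA).trans le_sup_right)

/-- In a finite `NC`-group, relative complements exist over each normal subgroup `N` of `G` for
the subgroups `K ≥ N` that are normal in a given normal subgroup `H`. -/
theorem IsNCGroup.exists_relative_complement {G : Type*} [Group G] [Finite G] (hG : IsNCGroup G)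
    (H : Subgroup G) [hH : H.Normal] (N : Subgroup G) (hN : N.Normal) (hNH : N ≤ H)
    (K : Subgroup G) (hNK : N ≤ K) (hKH : K ≤ H) (hK : H ≤ normalizer (K : Set G)) :
    ∃ L : Subgroup G, K ⊔ L = H ∧ K ⊓ L = N := by
  induction N using WellFoundedGT.induction generalizing K with
  | ind N ih =>
    rcases hNH.eq_or_lt with rfl | hlt
    · exact ⟨N, sup_eq_right.2 hKH, inf_eq_right.2 hNK⟩
    obtain ⟨N', hN'H, hmin⟩ := (Set.toFinite {X : Subgroup G | X.Normal ∧ N < X}).exists_le_minimal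
      (show H ∈ _ from ⟨hH, hlt⟩)
    have hN'n : N'.Normal := hmin.prop.1
    have hNN' : N < N' := hmin.prop.2
    obtain ⟨L, hLs, hLi⟩ := ih N' hNN' hN'n hN'H (K ⊔ N') le_sup_right (sup_le hKH hN'H)
      (le_normalizer_sup hK le_normalizer_of_normal)
    obtain ⟨M, hMH, hNM, hMN', hMs, hMi⟩ :=
      exists_invariant_complement_of_chief_factor (B := K ⊓ N') hN'H hmin
        (le_inf hNK hNN'.le) inf_le_right (le_normalizer_inf hK le_normalizer_of_normal)
    obtain ⟨C, hC⟩ := hG N' hN'n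
    have hN'L : N' ≤ L := hLi.symm.le.trans inf_le_right
    have hLH : L ≤ H := le_sup_right.trans hLs.le
    -- As `N' ≤ L`, Dedekind's law gives `L = N' (L ⊓ C)`; replacing `N'` by `M` removes the overlap
    -- with `K ⊓ N'` beyond `N`.
    refine ⟨M ⊔ L ⊓ C, le_antisymm ?_ ?_, le_antisymm ?_ ?_⟩
    · exact sup_le hKH (sup_le (hMN'.trans hN'H) (inf_le_left.trans hLH))
    · have hKM : N' ≤ K ⊔ (M ⊔ L ⊓ C) :=
        hMs.symm.le.trans (sup_le_sup inf_le_left le_sup_left)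
      refine hLs.symm.le.trans (sup_le (sup_le le_sup_left hKM) fun x hx => ?_)
      have hxt : x ∈ N' ⊔ C := by rw [hC.sup_eq_top]; trivial
      obtain ⟨n, hn, c, hc, rfl⟩ := (mem_sup_of_le_normalizer le_normalizer_of_normal).1 hxt
      have hcL : c ∈ L := by simpa using mul_mem (inv_mem (hN'L hn)) hx
      exact mul_mem (hKM hn) ((le_sup_right.trans le_sup_right : L ⊓ C ≤ K ⊔ (M ⊔ L ⊓ C)) ⟨hcL, hc⟩)
    · rintro x ⟨hxK, hx⟩
      obtain ⟨m, hm, e, he, rfl⟩ :=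
        (mem_sup_of_le_normalizer ((inf_le_left.trans hLH).trans hMH)).1 hx
      have hmN' : m ∈ N' := hMN' hm
      -- The product lies in `(K ⊔ N') ⊓ L = N'`, which forces `e` into `N' ⊓ C = ⊥`.
      have hmeN' : m * e ∈ N' :=
        hLi.le ⟨(le_sup_left : K ≤ K ⊔ N') hxK, mul_mem (hN'L hmN') he.1⟩
      have heN' : e ∈ N' := by simpa using mul_mem (inv_mem hmN') hmeN'
      have he1 : e = 1 := disjoint_def.1 hC.disjoint heN' he.2
      subst he1
      rw [mul_one] at *
      exact hMi.le ⟨⟨hxK, hmN'⟩, hm⟩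
    · exact le_inf hNK (hNM.trans le_sup_left)

/-- Normal subgroups of finite `NC`-groups are `NC`-groups. -/
theorem IsNCGroup.of_normal {G : Type*} [Group G] [Finite G] (hG : IsNCGroup G)
    (H : Subgroup G) [H.Normal] : IsNCGroup H := by
  intro K hK
  have hKn : H ≤ normalizer ((K.map H.subtype : Subgroup G) : Set G) := by
    rw [le_normalizer_iff]
    rintro h hh _ ⟨k, hk, rfl⟩
    exact ⟨⟨h, hh⟩ * k * ⟨h, hh⟩⁻¹, hK.conj_mem k hk ⟨h, hh⟩, rfl⟩
  obtain ⟨L, hs, hi⟩ := hG.exists_relative_complement H ⊥ inferInstance bot_le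
    (K.map H.subtype) bot_le (map_subtype_le K) hKn
  have hLH : L ≤ H := le_sup_right.trans hs.le
  refine ⟨L.subgroupOf H, isComplement'_of_disjoint_and_mul_eq_univ ?_ ?_⟩
  · rw [disjoint_def]
    intro x hxK hxL
    have : (x : G) ∈ (⊥ : Subgroup G) := hi.le ⟨⟨x, hxK, rfl⟩, hxL⟩
    exact Subtype.ext (mem_bot.1 this)
  · refine Set.eq_univ_of_forall fun x => ?_
    obtain ⟨_, ⟨k, hk, rfl⟩, l, hl, hkl⟩ :=
      (mem_sup_of_le_normalizer (hLH.trans hKn)).1 (hs.symm.le x.2)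
    exact ⟨k, hk, ⟨l, hLH hl⟩, hl, Subtype.ext hkl⟩

/-- Being an `NC`-group is invariant under isomorphism. -/
theorem IsNCGroup.of_mulEquiv {G G' : Type*} [Group G] [Group G'] (hG : IsNCGroup G)
    (e : G ≃* G') : IsNCGroup G' := by
  intro N hN
  obtain ⟨C, hC⟩ := hG (N.comap e.toMonoidHom) (hN.comap _)
  refine ⟨C.map e.toMonoidHom, isComplement'_of_disjoint_and_mul_eq_univ ?_ ?_⟩
  · rw [disjoint_def]
    rintro _ hx ⟨c, hc, rfl⟩
    have : c = 1 := disjoint_def.1 hC.disjoint hx hc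
    simp [this]
  · refine Set.eq_univ_of_forall fun x => ?_
    obtain ⟨⟨n, c⟩, hnc⟩ := hC.2 (e.symm x)
    exact ⟨e n, n.2, e c, ⟨c, c.2, rfl⟩, by simpa using congrArg e hnc⟩

theorem mainTheorem5 {G : Type*} [Group G] [Finite G] (hG : IsNCGroup G)
    (H : Subgroup G) (hH : H.IsSubnormal) : IsNCGroup H := by
  induction hH with
  | top => exact hG.of_mulEquiv topEquiv.symm
  | step H K h_le _ hN ih =>
    exact (ih.of_normal (H.subgroupOf K)).of_mulEquiv (subgroupOfEquivOfLe h_le)
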